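/- Let $k$ be a field with algebraic closure $\bar k$, let $n \ge 1$, let $g_1,\dots,g_n \in k[x]$ be non-constant univariate polynomials, let $\mathbf a_1,\dots,\mathbf a_n \in k^n$ and $\mathbf b = (b_1,\dots,b_n)^\intercal \in k^n$, and put $f_i = g_i(\mathbf a_i^\intercal \mathbf x + b_i) \in P = k[x_1,\dots,x_n]$ and $\mathcal F = \{f_1,\dots,f_n\}$ (the affinely derived polynomial system of the $(g_i,\mathbf a_i,b_i)$). Assume that the matrix $\mathbf A = (\mathbf a_1 \ \dots \ \mathbf a_n)^\intercal \in k^{n\times n}$ has rank $n$. Then: 1. LEX and DRL Gröbner bases of $\mathcal F$ are obtained by an affine transformation: the affine change of variables $\mathbf y = \mathbf A\mathbf x + \mathbf b$ is invertible, with inverse $\mathbf x = \mathbf A^{-1}\mathbf y - \mathbf A^{-1}\mathbf b$; in the coordinates $\mathbf y$ the polynomial $f_i$ becomes $g_i(y_i)$; and $\{g_1(y_1),\dots,g_n(y_n)\}$ is a Gröbner basis of the transformed ideal $(\mathcal F) \subset k[y_1,\dots,y_n]$ for the lexicographic (LEX) and for the degree reverse lexicographic (DRL) term order, for every ordering of the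 variables $y_1, \dots, y_n$. (A Gröbner basis of an ideal $I$ is a finite generating set of $I$ whose leading terms generate the ideal of leading terms of all elements of $I$.) 2. $\mathcal F$ is zero-dimensional: $P/(\mathcal F)$ has Krull dimension $0$, and the zero locus of $\mathcal F$ in $\bar k^n$ is finite. 3. $P/(\mathcal F)$ is a finite-dimensional $k$-vector space, and $\dim_k P/(\mathcal F) = \prod_{i=1}^n \deg g_i$. 4. Let $\mathcal G \subset \bar k[x_1,\dots,x_n]$ be a set of polynomials with $\mathcal F \subset \mathcal G$ and $(\mathcal G) \ne (1)$, and let $\mathcal G^{\mathrm{hom}} = \{ h^{\mathrm{hom}} \mid h \in \mathcal G\} \subset \bar k[x_0,\dots,x_n]$, where $h^{\mathrm{hom}} = x_0^{\deg h}\, h(x_1/x_0,\dots,x_n/x_0)$. Then the ideal $J = (\mathcal G^{\mathrm{hom}})$ is in generic coordinates, that is: $J$ is homogeneous, its zero locus $\mathcal Z_+(J)$ in $\mathbb P^n_{\bar k}$ is finite, and either $\mathcal Z_+(J)$ is empty or $x_0$ is not a zero divisor on $\bar k[x_0,\dots,x_n]/J^{\mathrm{sat}}$, where $J^{\mathrm{sat}}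 = \bigcup_{i \ge 1} \big( J : (x_0,\dots,x_n)^i \big)$. 5. If in addition $k$ is a finite field with $q$ elements and $g_i \mid x^q - x$ for all $1 \le i \le n$, then every ideal $I \subset k[x_1,\dots,x_n]$ with $\mathcal F \subset I$ is radical. -/

import Mathlib

noncomputable section

attribute [local instance] MvPolynomial.gradedAlgebra

namespace AffineSystem

/-! ### Term orders -/

/-- The set of exponent vectors in `n` variables, to be equipped with the degree reverse
lexicographic order. -/
def DegRevLex (n : ℕ) : Type := Fin n →₀ ℕ

namespace DegRevLex

variable {n : ℕ}

instance : AddCommMonoid (DegRevLex n) := inferInstanceAs (AddCommMonoid (Fin n →₀ ℕ))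

/-- The exponent vector in which the variables are listed in the opposite order. -/
def rev (c : Fin n →₀ ℕ) : Fin n →₀ ℕ := Finsupp.domCongr Fin.revPerm c

/-- Degree first; ties are broken by the opposite of the lexicographic order for the reversed list
of variables. -/
def key (c : DegRevLex n) : ℕ ×ₗ (Lex (Fin n →₀ ℕ))ᵒᵈ :=
  toLex (Finsupp.degree (show Fin n →₀ ℕ from c), OrderDual.toDual (toLex (rev c)))

theorem key_injective : Function.Injective (key (n := n)) := by
  intro c d h
  have h2 := congrArg (fun z => ofLex (OrderDual.ofDual (ofLex z).2)) h
  exact (Finsupp.domCongr Fin.revPerm).injective h2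

instance : LinearOrder (DegRevLex n) := LinearOrder.lift' key key_injective

theorem le_iff_key {c d : DegRevLex n} : c ≤ d ↔ key c ≤ key d := Iff.rfl

theorem lt_iff_key {c d : DegRevLex n} : c < d ↔ key c < key d := Iff.rfl

instance : IsOrderedAddMonoid (DegRevLex n) where
  add_le_add_left a b h c := by
    rw [le_iff_key, Prod.Lex.le_iff] at h ⊢
    simp only [key, ofLex_toLex, OrderDual.toDual_le_toDual] at h ⊢
    have hd : ∀ x y : DegRevLex n, Finsupp.degree (show Fin n →₀ ℕ from x + y) =
        Finsupp.degree (show Fin n →₀ ℕ from x) + Finsupp.degree (show Fin n →₀ ℕ from y) :=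
      fun x y => map_add Finsupp.degree (show Fin n →₀ ℕ from x) (show Fin n →₀ ℕ from y)
    have hr : ∀ x y : DegRevLex n, toLex (rev (x + y)) = toLex (rev x) + toLex (rev y) :=
      fun x y => map_add (Finsupp.domCongr Fin.revPerm) (show Fin n →₀ ℕ from x)
        (show Fin n →₀ ℕ from y)
    rw [hd, hd, hr, hr]
    simpa using h

theorem monotone_id : Monotone (fun c : Fin n →₀ ℕ => (show DegRevLex n from c)) := by
  intro c d h
  obtain ⟨e, rfl⟩ := exists_add_of_le h
  rw [le_iff_key, Prod.Lex.le_iff]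
  simp only [key, ofLex_toLex, OrderDual.toDual_le_toDual]
  have hd : Finsupp.degree (c + e) = Finsupp.degree c + Finsupp.degree e := map_add _ _ _
  by_cases he : e = 0
  · right
    subst he
    simp
  · left
    have : Finsupp.degree e ≠ 0 := fun h0 => he ((Finsupp.degree_eq_zero_iff e).1 h0)
    change Finsupp.degree c < Finsupp.degree (c + e)
    omega

instance : WellFoundedLT (DegRevLex n) := by
  have h : WellQuasiOrdered (fun a b : Fin n →₀ ℕ => a ≤ b) := wellQuasiOrdered_le
  have h2 : WellQuasiOrderedLE (DegRevLex n) :=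
    ⟨fun f => by
      obtain ⟨i, j, hij, hle⟩ := h f
      exact ⟨i, j, hij, monotone_id hle⟩⟩
  infer_instance

end DegRevLex

/-- The degree reverse lexicographic order with `x₀ > x₁ > ⋯ > xₙ₋₁`. -/
def degRevLex (n : ℕ) : MonomialOrder (Fin n) where
  syn := DegRevLex n
  toSyn :=
  { toEquiv := Equiv.refl _
    map_add' := fun _ _ => rfl }
  toSyn_monotone := DegRevLex.monotone_id

/-- Among exponents of the same degree, `c` is smaller than `d` if and only if at the last place
where they differ the entry of `c` is the larger one. -/
theorem degRevLex_lt_iff {n : ℕ} {c d : Fin n →₀ ℕ} :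
    (degRevLex n).toSyn c < (degRevLex n).toSyn d ↔
      c.degree < d.degree ∨
        (c.degree = d.degree ∧ ∃ j, (∀ i, j < i → c i = d i) ∧ d j < c j) := by
  change DegRevLex.key (n := n) c < DegRevLex.key (n := n) d ↔ _
  rw [Prod.Lex.lt_iff]
  simp only [DegRevLex.key, ofLex_toLex, OrderDual.toDual_lt_toDual]
  refine or_congr Iff.rfl (and_congr Iff.rfl ?_)
  rw [Finsupp.Lex.lt_iff]
  simp only [ofLex_toLex, DegRevLex.rev, Finsupp.domCongr_apply, Finsupp.equivMapDomain_apply,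
    Fin.revPerm_symm, Fin.revPerm_apply]
  constructor
  · rintro ⟨j, h1, h2⟩
    refine ⟨j.rev, fun i hi => ?_, h2⟩
    have := h1 i.rev (by rw [← Fin.rev_lt_rev, Fin.rev_rev]; exact hi)
    simpa using this.symm
  · rintro ⟨j, h1, h2⟩
    refine ⟨j.rev, fun i hi => ?_, by simpa using h2⟩
    exact (h1 i.rev (by rw [← Fin.rev_lt_rev, Fin.rev_rev]; exact hi)).symm

/-- The term order obtained from `m` by letting the variable `e j` play the role of `j`. -/
def reorder {σ : Type*} (m : MonomialOrder σ) (e : Equiv.Perm σ) : MonomialOrder σ where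
  syn := m.syn
  toSyn := (Finsupp.domCongr e.symm).trans m.toSyn
  toSyn_monotone := by
    intro c d h
    refine m.toSyn_monotone fun i => ?_
    simpa using h (e i)

/-- The lexicographic order with `x_{e 0} > x_{e 1} > ⋯`. -/
def LEX {n : ℕ} (e : Equiv.Perm (Fin n)) : MonomialOrder (Fin n) := reorder MonomialOrder.lex e

/-- The degree reverse lexicographic order with `x_{e 0} > x_{e 1} > ⋯`. -/
def DRL {n : ℕ} (e : Equiv.Perm (Fin n)) : MonomialOrder (Fin n) := reorder (degRevLex n) e

/-- The set `G` is a Gröbner basis of the ideal `I` for the term order `m`. -/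
def IsGroebnerBasis {σ k : Type*} [Field k] (m : MonomialOrder σ)
    (I : Ideal (MvPolynomial σ k)) (G : Set (MvPolynomial σ k)) : Prop :=
  G.Finite ∧ Ideal.span G = I ∧
    Ideal.span (m.leadingTerm '' (I : Set (MvPolynomial σ k))) = Ideal.span (m.leadingTerm '' G)

/-! ### Affinely derived systems -/

/-- The affine form `aᵀ x + b`. -/
def affineForm {k : Type*} [Field k] {n : ℕ} (a : Fin n → k) (b : k) : MvPolynomial (Fin n) k :=
  ∑ j, MvPolynomial.C (a j) * MvPolynomial.X j + MvPolynomial.C b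

/-- The polynomials `g i (aᵢᵀ x + b i)`, where `aᵢ` is the `i`-th row of `A`. -/
def affinelyDerived {k : Type*} [Field k] {m n : ℕ} (g : Fin m → Polynomial k)
    (A : Matrix (Fin m) (Fin n) k) (b : Fin m → k) (i : Fin m) : MvPolynomial (Fin n) k :=
  Polynomial.aeval (affineForm (A i) (b i)) (g i)

/-! ### Zero loci -/

/-- The zero locus of `I` in affine space over the extension `L` of `k`. -/
def zeroLocus {k : Type*} [Field k] (L : Type*) [Field L] [Algebra k L] {n : ℕ}
    (I : Ideal (MvPolynomial (Fin n) k)) : Set (Fin n → L) :=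
  {x | ∀ f ∈ I, MvPolynomial.aeval x f = 0}

/-- The projective zero locus of a homogeneous ideal `I` over the extension `L` of `k`. -/
def projZeroLocus {k : Type*} [Field k] (L : Type*) [Field L] [Algebra k L] {n : ℕ}
    (I : Ideal (MvPolynomial (Fin n) k)) : Set (Projectivization L (Fin n → L)) :=
  {p | ∀ f ∈ I, MvPolynomial.aeval p.rep f = 0}

/-! ### Homogenization, saturation, generic coordinates -/

/-- The homogenization `x₀ ^ deg f * f (x₁ / x₀, …, xₙ / x₀)`. -/
def homogenize {k : Type*} [Field k] {n : ℕ} (f : MvPolynomial (Fin n) k) :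
    MvPolynomial (Fin (n + 1)) k :=
  ∑ d ∈ f.support, MvPolynomial.monomial (Finsupp.cons (f.totalDegree - d.degree) d) (f.coeff d)

/-- The saturation `I : J^∞ = ⋃ᵢ (I : J ^ i)`. -/
def saturation {R : Type*} [CommRing R] (I J : Ideal R) : Ideal R where
  carrier := {f | ∃ i : ℕ, ∀ g ∈ J ^ i, f * g ∈ I}
  zero_mem' := ⟨0, fun g _ => by simp⟩
  add_mem' := by
    rintro f f' ⟨i, hi⟩ ⟨j, hj⟩
    refine ⟨max i j, fun g hg => ?_⟩
    rw [add_mul]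
    exact I.add_mem (hi g (Ideal.pow_le_pow_right (le_max_left i j) hg))
      (hj g (Ideal.pow_le_pow_right (le_max_right i j) hg))
  smul_mem' := by
    rintro c f ⟨i, hi⟩
    refine ⟨i, fun g hg => ?_⟩
    rw [smul_eq_mul, mul_assoc]
    exact I.mul_mem_left c (hi g hg)

/-- The irrelevant ideal `(x₀, …, xₙ)`. -/
def irrelevantIdeal (k : Type*) [Field k] (n : ℕ) : Ideal (MvPolynomial (Fin (n + 1)) k) :=
  Ideal.span (Set.range MvPolynomial.X)

/-- An ideal of `K[x₀, …, xₙ]`, `K` an infinite field, is in generic coordinates: it is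
homogeneous, has finitely many projective zeros over the algebraic closure of `K`, and either it has
none or `x₀` is not a zero divisor modulo its saturation with respect to `(x₀, …, xₙ)`. -/
def IsInGenericCoordinates {K : Type*} [Field K] {n : ℕ}
    (I : Ideal (MvPolynomial (Fin (n + 1)) K)) : Prop :=
  I.IsHomogeneous (MvPolynomial.homogeneousSubmodule (Fin (n + 1)) K) ∧
    (projZeroLocus (AlgebraicClosure K) I).Finite ∧
      (projZeroLocus (AlgebraicClosure K) I = ∅ ∨
        Ideal.Quotient.mk (saturation I (irrelevantIdeal K n)) (MvPolynomial.X 0) ∈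
          nonZeroDivisors
            (MvPolynomial (Fin (n + 1)) K ⧸ saturation I (irrelevantIdeal K n)))

end AffineSystem

end

/-!
In the coordinates `y = A x + b` the system becomes `{g i (y i)}`, one univariate polynomial in each
variable, and its quotient is the tensor product of the `k[y] / (g i)`. The monomials with all
exponents `d i < deg (g i)` map to distinct members of the product basis of this tensor product.
Hence an element of the ideal that is reduced modulo the `g i (y i)` vanishes, and by division with
remainder the system is a Gröbner basis for every term order.

For generic coordinates, the homogenization of `f i = g i (aᵢᵀ x + b i)` is congruent modulo `x₀` to
a nonzero constant times a power of the linear form `aᵢᵀ x`. So `J` and `x₀` together generate an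
ideal `J + (x₀)` that contains a power of the irrelevant ideal: there are no zeros at infinity, and
`x₀ f ∈ J^sat` implies `f ∈ J^sat`.

If the `g i` are separable, the differentials of the affine forms vanish in any quotient by an ideal
`I` that contains the system. These forms generate the quotient, which is therefore unramified over
`k`, hence reduced. Divisors of `x ^ q - x` are separable.
-/

noncomputable section

namespace AffineSystem

open MvPolynomial
open scoped TensorProduct

section UnivariateSystem

variable {σ R : Type*} [CommRing R]

/-- The ideal `(g i (X i) | i)` generated by one univariate polynomial in each variable. -/
def univariateIdeal (g : σ → Polynomial R) : Ideal (MvPolynomial σ R) :=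
  Ideal.span (Set.range fun i => Polynomial.aeval (X i) (g i))

theorem aeval_X_mem_univariateIdeal (g : σ → Polynomial R) (i : σ) :
    Polynomial.aeval (X i) (g i) ∈ univariateIdeal g :=
  Ideal.subset_span ⟨i, rfl⟩

/-- The canonical map from `R[X i | i]` to the tensor product of the algebras `R[X] / (g i)`. -/
def toPiTensorAdjoinRoot [DecidableEq σ] (g : σ → Polynomial R) :
    MvPolynomial σ R →ₐ[R] ⨂[R] i, AdjoinRoot (g i) :=
  aeval fun i => PiTensorProduct.singleAlgHom i (AdjoinRoot.root (g i))

theorem toPiTensorAdjoinRoot_eq_zero_of_mem [DecidableEq σ] {g : σ → Polynomial R}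
    {f : MvPolynomial σ R} (hf : f ∈ univariateIdeal g) : toPiTensorAdjoinRoot g f = 0 := by
  suffices univariateIdeal g ≤ RingHom.ker (toPiTensorAdjoinRoot g) from this hf
  rw [univariateIdeal, Ideal.span_le]
  rintro _ ⟨i, rfl⟩
  rw [SetLike.mem_coe, RingHom.mem_ker, ← Polynomial.aeval_algHom_apply, toPiTensorAdjoinRoot,
    aeval_X, Polynomial.aeval_algHom_apply, AdjoinRoot.aeval_eq, AdjoinRoot.mk_self, map_zero]

theorem toPiTensorAdjoinRoot_monomial [Finite σ] [DecidableEq σ] (g : σ → Polynomial R)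
    (d : σ →₀ ℕ) (a : R) :
    toPiTensorAdjoinRoot g (monomial d a) =
      a • PiTensorProduct.tprod R fun i => AdjoinRoot.root (g i) ^ d i := by
  have := Fintype.ofFinite σ
  have hprod : (∏ i, Pi.mulSingle i (AdjoinRoot.root (g i) ^ d i) : ∀ i, AdjoinRoot (g i)) =
      fun i => AdjoinRoot.root (g i) ^ d i :=
    Finset.univ_prod_mulSingle _
  rw [toPiTensorAdjoinRoot, aeval_monomial, Finsupp.prod_fintype _ _ fun _ => pow_zero _,
    ← Algebra.smul_def, ← hprod]
  simp only [← map_pow]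
  exact congrArg (a • ·) (PiTensorProduct.tprod_prod _ _).symm

/-- The canonical map from the `i`-th factor `R[X] / (g i)` to `R[X i | i] / (g i (X i) | i)`. -/
def adjoinRootToQuotient (g : σ → Polynomial R) (i : σ) :
    AdjoinRoot (g i) →ₐ[R] MvPolynomial σ R ⧸ univariateIdeal g :=
  AdjoinRoot.liftAlgHom (g i) (Algebra.ofId R _) (Ideal.Quotient.mkₐ R _ (X i)) <| by
    change Polynomial.aeval (Ideal.Quotient.mkₐ R (univariateIdeal g) (X i)) (g i) = 0
    rw [Polynomial.aeval_algHom_apply]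
    exact Ideal.Quotient.eq_zero_iff_mem.2 (aeval_X_mem_univariateIdeal g i)

theorem adjoinRootToQuotient_root (g : σ → Polynomial R) (i : σ) :
    adjoinRootToQuotient g i (AdjoinRoot.root (g i)) = Ideal.Quotient.mk _ (X i) :=
  AdjoinRoot.liftAlgHom_root ..

/-- The inverse of the map induced by `toPiTensorAdjoinRoot`: it multiplies the images of the
factors. -/
def ofPiTensorAdjoinRoot [Fintype σ] (g : σ → Polynomial R) :
    (⨂[R] i, AdjoinRoot (g i)) →ₐ[R] MvPolynomial σ R ⧸ univariateIdeal g :=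
  PiTensorProduct.liftAlgHom
    ((MultilinearMap.mkPiAlgebra R σ _).compLinearMap fun i =>
      (adjoinRootToQuotient g i).toLinearMap)
    (by simp) (by simp [Finset.prod_mul_distrib])

theorem ofPiTensorAdjoinRoot_tprod [Fintype σ] (g : σ → Polynomial R)
    (x : ∀ i, AdjoinRoot (g i)) :
    ofPiTensorAdjoinRoot g (PiTensorProduct.tprod R x) = ∏ i, adjoinRootToQuotient g i (x i) :=
  PiTensorProduct.lift.tprod x

theorem ofPiTensorAdjoinRoot_singleAlgHom [Fintype σ] [DecidableEq σ] (g : σ → Polynomial R)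
    (i : σ) (x : AdjoinRoot (g i)) :
    ofPiTensorAdjoinRoot g (PiTensorProduct.singleAlgHom i x) = adjoinRootToQuotient g i x := by
  rw [PiTensorProduct.singleAlgHom_apply, ofPiTensorAdjoinRoot_tprod, Finset.prod_eq_single i]
  · simp
  · intro j _ hj
    simp [Pi.mulSingle_eq_of_ne hj]
  · simp

/-- The quotient by one univariate polynomial in each variable is the tensor product of the
univariate quotients. -/
def quotientUnivariateIdealEquiv [Fintype σ] [DecidableEq σ] (g : σ → Polynomial R) :
    (MvPolynomial σ R ⧸ univariateIdeal g) ≃ₐ[R] ⨂[R] i, AdjoinRoot (g i) :=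
  AlgEquiv.ofAlgHom
    (Ideal.Quotient.liftₐ _ (toPiTensorAdjoinRoot g) fun _ hf =>
      toPiTensorAdjoinRoot_eq_zero_of_mem hf)
    (ofPiTensorAdjoinRoot g)
    (PiTensorProduct.algHom_ext fun i => AdjoinRoot.algHom_ext <| by
      rw [AlgHom.comp_apply, AlgHom.comp_apply, ofPiTensorAdjoinRoot_singleAlgHom,
        adjoinRootToQuotient_root]
      exact aeval_X _ i)
    (Ideal.Quotient.algHom_ext _ <| MvPolynomial.algHom_ext fun i => by
      change ofPiTensorAdjoinRoot g (toPiTensorAdjoinRoot g (X i)) = _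
      rw [toPiTensorAdjoinRoot, aeval_X, ofPiTensorAdjoinRoot_singleAlgHom,
        adjoinRootToQuotient_root]
      rfl)

variable {k : Type*} [Field k]

/-- The basis of `⨂ i, k[X] / (g i)` formed by the pure tensors of powers of the roots. -/
def piTensorRootBasis [Finite σ] {g : σ → Polynomial k} (hg : ∀ i, g i ≠ 0) :
    Module.Basis (∀ i, Fin (g i).natDegree) k (⨂[k] i, AdjoinRoot (g i)) :=
  Basis.piTensorProduct fun i => (AdjoinRoot.powerBasis (hg i)).basis

theorem piTensorRootBasis_apply [Finite σ] {g : σ → Polynomial k} (hg : ∀ i, g i ≠ 0)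
    (e : ∀ i, Fin (g i).natDegree) :
    piTensorRootBasis hg e =
      PiTensorProduct.tprod k fun i => AdjoinRoot.root (g i) ^ (e i : ℕ) := by
  refine (Basis.piTensorProduct_apply _ e).trans (congrArg _ (funext fun i => ?_))
  exact (AdjoinRoot.powerBasis (hg i)).basis_eq_pow (e i)

theorem finite_quotient_univariateIdeal [Finite σ] {g : σ → Polynomial k} (hg : ∀ i, g i ≠ 0) :
    Module.Finite k (MvPolynomial σ k ⧸ univariateIdeal g) := by
  classical
  have := Fintype.ofFinite σ
  have := Module.Finite.of_basis (piTensorRootBasis hg)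
  exact Module.Finite.equiv (quotientUnivariateIdealEquiv g).symm.toLinearEquiv

theorem finrank_quotient_univariateIdeal [Fintype σ] {g : σ → Polynomial k} (hg : ∀ i, g i ≠ 0) :
    Module.finrank k (MvPolynomial σ k ⧸ univariateIdeal g) = ∏ i, (g i).natDegree := by
  classical
  rw [(quotientUnivariateIdealEquiv g).toLinearEquiv.finrank_eq,
    Module.finrank_eq_card_basis (piTensorRootBasis hg), Fintype.card_pi]
  simp only [Fintype.card_fin]

theorem linearIndepOn_tprod_root_pow [Finite σ] {g : σ → Polynomial k} (hg : ∀ i, g i ≠ 0)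
    {s : Set (σ →₀ ℕ)} (hs : ∀ d ∈ s, ∀ i, d i < (g i).natDegree) :
    LinearIndepOn k (fun d : σ →₀ ℕ =>
      PiTensorProduct.tprod k fun i => AdjoinRoot.root (g i) ^ d i) s := by
  let e : s → ∀ i, Fin (g i).natDegree := fun d i => ⟨d.1 i, hs d.1 d.2 i⟩
  have he : Function.Injective e := fun d d' h =>
    Subtype.ext <| Finsupp.ext fun i => congrArg Fin.val (congrFun h i)
  have hbasis : (fun d : s => PiTensorProduct.tprod k fun i => AdjoinRoot.root (g i) ^ d.1 i) =
      piTensorRootBasis hg ∘ e :=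
    funext fun d => (piTensorRootBasis_apply hg (e d)).symm
  change LinearIndependent k fun d : s =>
    PiTensorProduct.tprod k fun i => AdjoinRoot.root (g i) ^ d.1 i
  rw [hbasis]
  exact (piTensorRootBasis hg).linearIndependent.comp e he

theorem eq_zero_of_mem_univariateIdeal [Finite σ] {g : σ → Polynomial k} (hg : ∀ i, g i ≠ 0)
    {f : MvPolynomial σ k} (hf : f ∈ univariateIdeal g)
    (hred : ∀ d ∈ f.support, ∀ i, d i < (g i).natDegree) : f = 0 := by
  classical
  have hsum : ∑ d ∈ f.support, f.coeff d •
      PiTensorProduct.tprod k (fun i => AdjoinRoot.root (g i) ^ d i) = 0 := by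
    rw [← toPiTensorAdjoinRoot_eq_zero_of_mem hf]
    conv_rhs => rw [f.as_sum, map_sum]
    simp only [toPiTensorAdjoinRoot_monomial]
  ext d
  by_cases hd : d ∈ f.support
  · exact linearIndepOn_finset_iff.1 (linearIndepOn_tprod_root_pow hg hred) _ hsum d hd
  · rw [notMem_support_iff.1 hd, coeff_zero]

end UnivariateSystem

section GroebnerBasis

variable {σ k : Type*} [Field k] {m : MonomialOrder σ} {G : Set (MvPolynomial σ k)}

theorem exists_degree_le_degree_of_mem_span (h0 : 0 ∉ G)
    (hred : ∀ r ∈ Ideal.span G, (∀ c ∈ r.support, ∀ p ∈ G, ¬ m.degree p ≤ c) → r = 0)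
    {f : MvPolynomial σ k} (hf : f ∈ Ideal.span G) (hf0 : f ≠ 0) :
    ∃ p ∈ G, m.degree p ≤ m.degree f := by
  obtain ⟨q, r, hfr, hdeg, hr⟩ := m.div_set
    (fun p hp => (m.leadingCoeff_ne_zero_iff.2 fun h => h0 (h ▸ hp)).isUnit) f
  have hr0 : r = 0 := by
    refine hred r ?_ hr
    rw [← add_sub_cancel_left (Finsupp.linearCombination _ _ q) r, ← hfr]
    refine sub_mem hf ?_
    rw [Ideal.span, Finsupp.span_eq_range_linearCombination]
    exact LinearMap.mem_range_self _ q
  rw [hr0, add_zero] at hfr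
  have hcoeff : f.coeff (m.degree f) ≠ 0 := m.leadingCoeff_ne_zero_iff.2 hf0
  conv at hcoeff => enter [1, 2]; rw [hfr, Finsupp.linearCombination_apply, Finsupp.sum]
  rw [coeff_sum] at hcoeff
  obtain ⟨p, -, hp⟩ := Finset.exists_ne_zero_of_sum_ne_zero hcoeff
  rw [smul_eq_mul, mul_comm] at hp
  have hpq : p.1 * q p ≠ 0 := fun h => hp (by rw [h, coeff_zero])
  have hdeg_eq : m.degree (p.1 * q p) = m.degree f :=
    m.toSyn.injective (le_antisymm (hdeg p) (m.le_degree (mem_support_iff.2 hp)))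
  refine ⟨p, p.2, ?_⟩
  rw [← hdeg_eq, m.degree_mul' hpq]
  exact le_self_add

theorem isGroebnerBasis_span (hG : G.Finite) (h0 : 0 ∉ G)
    (hred : ∀ r ∈ Ideal.span G, (∀ c ∈ r.support, ∀ p ∈ G, ¬ m.degree p ≤ c) → r = 0) :
    IsGroebnerBasis m (Ideal.span G) G := by
  refine ⟨hG, rfl, le_antisymm ?_ (Ideal.span_mono (Set.image_mono Ideal.subset_span))⟩
  rw [Ideal.span_le]
  rintro _ ⟨f, hf, rfl⟩
  rcases eq_or_ne f 0 with rfl | hf0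
  · simp
  obtain ⟨p, hp, hle⟩ := exists_degree_le_degree_of_mem_span h0 hred hf hf0
  have hp0 : m.leadingCoeff p ≠ 0 := m.leadingCoeff_ne_zero_iff.2 fun h => h0 (h ▸ hp)
  have hdvd : m.leadingTerm p ∣ m.leadingTerm f :=
    monomial_dvd_monomial.2 ⟨Or.inr hle, (isUnit_iff_ne_zero.2 hp0).dvd⟩
  exact Ideal.mem_of_dvd _ hdvd (Ideal.subset_span ⟨p, hp, rfl⟩)

end GroebnerBasis

section UnivariateDegree

variable {σ R : Type*} [CommSemiring R]

theorem coeff_single_aeval_X (i : σ) (p : Polynomial R) (j : ℕ) :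
    (Polynomial.aeval (X i : MvPolynomial σ R) p).coeff (Finsupp.single i j) = p.coeff j := by
  classical
  rw [Polynomial.aeval_eq_sum_range' (n := max p.natDegree j + 1) (by omega)]
  simp [coeff_sum, coeff_X_pow, (Finsupp.single_injective i).eq_iff]

theorem degree_aeval_X (m : MonomialOrder σ) (i : σ) (p : Polynomial R) :
    m.degree (Polynomial.aeval (X i : MvPolynomial σ R) p) = Finsupp.single i p.natDegree := by
  rcases eq_or_ne p 0 with rfl | hp
  · simp
  apply m.toSyn.injective
  apply le_antisymm
  · rw [Polynomial.aeval_eq_sum_range]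
    refine m.degree_sum_le.trans (Finset.sup_le fun j hj => ?_)
    rw [X_pow_eq_monomial, smul_monomial]
    exact (m.degree_monomial_le _).trans
      (m.toSyn_monotone (Finsupp.single_mono (Finset.mem_range_succ_iff.1 hj)))
  · apply m.le_degree
    rw [mem_support_iff, coeff_single_aeval_X]
    simpa using hp

end UnivariateDegree

theorem isGroebnerBasis_univariateIdeal {σ k : Type*} [Finite σ] [Field k] (m : MonomialOrder σ)
    {g : σ → Polynomial k} (hg : ∀ i, g i ≠ 0) :
    IsGroebnerBasis m (univariateIdeal g)
      (Set.range fun i => Polynomial.aeval (X i : MvPolynomial σ k) (g i)) := by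
  refine isGroebnerBasis_span (Set.finite_range _) ?_ fun r hr hred => ?_
  · rintro ⟨i, hi⟩
    exact hg i (transcendental_iff.1 (transcendental_X k i) _ hi)
  · refine eq_zero_of_mem_univariateIdeal hg hr fun d hd i => ?_
    have h := hred d hd _ ⟨i, rfl⟩
    simpa [degree_aeval_X] using h

section ChangeOfVariables

variable {k : Type*} [Field k] {n : ℕ}

theorem aeval_affineForm {S : Type*} [CommRing S] [Algebra k S] (v : Fin n → S) (a : Fin n → k)
    (c : k) :
    aeval v (affineForm a c) = ∑ j, algebraMap k S (a j) * v j + algebraMap k S c := by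
  simp [affineForm]

theorem aeval_affineForm_affineForm {m : ℕ} (A : Matrix (Fin m) (Fin n) k) (b a : Fin m → k)
    (c : k) :
    aeval (fun i => affineForm (A i) (b i)) (affineForm a c) =
      affineForm (Matrix.vecMul a A) (a ⬝ᵥ b + c) := by
  rw [aeval_affineForm]
  simp only [affineForm, algebraMap_eq, mul_add, Finset.sum_add_distrib, Finset.mul_sum,
    Matrix.vecMul, dotProduct, map_add, map_sum, map_mul, Finset.sum_mul]
  rw [Finset.sum_comm, add_assoc]
  simp only [mul_assoc]

theorem affineForm_one_zero (i : Fin n) :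
    affineForm ((1 : Matrix (Fin n) (Fin n) k) i) 0 = X i := by
  simp [affineForm, Matrix.one_apply]

theorem aeval_affineForm_eq_X {A B : Matrix (Fin n) (Fin n) k} (h : A * B = 1)
    {b c : Fin n → k} (hc : A.mulVec c + b = 0) (i : Fin n) :
    aeval (fun j => affineForm (B j) (c j)) (affineForm (A i) (b i)) = X i := by
  rw [aeval_affineForm_affineForm, ← Matrix.mul_apply_eq_vecMul, h,
    show A i ⬝ᵥ c + b i = 0 from congrFun hc i, affineForm_one_zero]

/-- The automorphism of `k[x₀, …, xₙ₋₁]` that substitutes `A x + b` for the variables. -/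
def affineEquiv (A : Matrix (Fin n) (Fin n) k) (b : Fin n → k) (hA : IsUnit A.det) :
    MvPolynomial (Fin n) k ≃ₐ[k] MvPolynomial (Fin n) k :=
  AlgEquiv.ofAlgHom (aeval fun i => affineForm (A i) (b i))
    (aeval fun i => affineForm (A⁻¹ i) (-(A⁻¹.mulVec b) i))
    (MvPolynomial.algHom_ext fun i => by
      rw [AlgHom.comp_apply, aeval_X]
      exact aeval_affineForm_eq_X (A.nonsing_inv_mul hA) (add_neg_cancel _) i)
    (MvPolynomial.algHom_ext fun i => by
      rw [AlgHom.comp_apply, aeval_X]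
      refine aeval_affineForm_eq_X (A.mul_nonsing_inv hA) (c := -(A⁻¹.mulVec b)) ?_ i
      rw [Matrix.mulVec_neg, Matrix.mulVec_mulVec, A.mul_nonsing_inv hA, Matrix.one_mulVec,
        neg_add_cancel])

theorem affineEquiv_X (A : Matrix (Fin n) (Fin n) k) (b : Fin n → k) (hA : IsUnit A.det)
    (i : Fin n) : affineEquiv A b hA (X i) = affineForm (A i) (b i) :=
  aeval_X _ i

theorem affineEquiv_symm_X (A : Matrix (Fin n) (Fin n) k) (b : Fin n → k) (hA : IsUnit A.det)
    (i : Fin n) :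
    (affineEquiv A b hA).symm (X i) = affineForm (A⁻¹ i) (-(A⁻¹.mulVec b) i) :=
  aeval_X _ i

theorem affineEquiv_symm_affinelyDerived (g : Fin n → Polynomial k)
    (A : Matrix (Fin n) (Fin n) k) (b : Fin n → k) (hA : IsUnit A.det) (i : Fin n) :
    (affineEquiv A b hA).symm (affinelyDerived g A b i) = Polynomial.aeval (X i) (g i) := by
  rw [AlgEquiv.symm_apply_eq, ← AlgEquiv.coe_toAlgHom, ← Polynomial.aeval_algHom_apply,
    AlgEquiv.coe_toAlgHom, affineEquiv_X, affinelyDerived]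

theorem map_span_affinelyDerived (g : Fin n → Polynomial k)
    (A : Matrix (Fin n) (Fin n) k) (b : Fin n → k) (hA : IsUnit A.det) :
    (Ideal.span (Set.range (affinelyDerived g A b))).map (affineEquiv A b hA).symm =
      univariateIdeal g := by
  rw [Ideal.map_span, ← Set.range_comp, univariateIdeal]
  exact congrArg (Ideal.span <| Set.range ·)
    (funext (affineEquiv_symm_affinelyDerived g A b hA))

/-- The quotient by an affinely derived system, computed in the coordinates `A x + b`. -/
def quotientAffinelyDerivedEquiv (g : Fin n → Polynomial k)
    (A : Matrix (Fin n) (Fin n) k) (b : Fin n → k) (hA : IsUnit A.det) :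
    (MvPolynomial (Fin n) k ⧸ Ideal.span (Set.range (affinelyDerived g A b))) ≃ₐ[k]
      MvPolynomial (Fin n) k ⧸ univariateIdeal g :=
  Ideal.quotientEquivAlg _ _ (affineEquiv A b hA).symm (map_span_affinelyDerived g A b hA).symm

theorem isGroebnerBasis_map_span_affinelyDerived (m : MonomialOrder (Fin n))
    {g : Fin n → Polynomial k} (hg : ∀ i, g i ≠ 0) (A : Matrix (Fin n) (Fin n) k)
    (b : Fin n → k) (hA : IsUnit A.det) :
    IsGroebnerBasis m
      ((Ideal.span (Set.range (affinelyDerived g A b))).map (affineEquiv A b hA).symm)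
      (Set.range fun i => (affineEquiv A b hA).symm (affinelyDerived g A b i)) := by
  rw [map_span_affinelyDerived]
  simp only [affineEquiv_symm_affinelyDerived]
  exact isGroebnerBasis_univariateIdeal m hg

theorem finite_quotient_affinelyDerived {g : Fin n → Polynomial k} (hg : ∀ i, g i ≠ 0)
    {A : Matrix (Fin n) (Fin n) k} (b : Fin n → k) (hA : IsUnit A.det) :
    Module.Finite k
      (MvPolynomial (Fin n) k ⧸ Ideal.span (Set.range (affinelyDerived g A b))) :=
  have := finite_quotient_univariateIdeal hg
  Module.Finite.equiv (quotientAffinelyDerivedEquiv g A b hA).symm.toLinearEquiv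

theorem finrank_quotient_affinelyDerived {g : Fin n → Polynomial k} (hg : ∀ i, g i ≠ 0)
    {A : Matrix (Fin n) (Fin n) k} (b : Fin n → k) (hA : IsUnit A.det) :
    Module.finrank k
        (MvPolynomial (Fin n) k ⧸ Ideal.span (Set.range (affinelyDerived g A b))) =
      ∏ i, (g i).natDegree :=
  (quotientAffinelyDerivedEquiv g A b hA).toLinearEquiv.finrank_eq.trans
    (finrank_quotient_univariateIdeal hg)

theorem isUnit_det_of_rank_eq {A : Matrix (Fin n) (Fin n) k} (hA : A.rank = n) :
    IsUnit A.det := by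
  rw [← Matrix.isUnit_iff_isUnit_det, ← Matrix.linearIndependent_rows_iff_isUnit,
    linearIndependent_iff_card_eq_finrank_span, Fintype.card_fin, Set.finrank,
    ← Matrix.rank_eq_finrank_span_row, hA]

theorem map_affinelyDerived {K : Type*} [Field K] [Algebra k K] {m : ℕ}
    (g : Fin m → Polynomial k) (A : Matrix (Fin m) (Fin n) k) (b : Fin m → k) (i : Fin m) :
    MvPolynomial.map (algebraMap k K) (affinelyDerived g A b i) =
      affinelyDerived (fun i => (g i).map (algebraMap k K)) (A.map (algebraMap k K))
        (fun i => algebraMap k K (b i)) i := by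
  have h : MvPolynomial.map (algebraMap k K) (affineForm (A i) (b i)) =
      affineForm (A.map (algebraMap k K) i) (algebraMap k K (b i)) := by
    simp [affineForm]
  rw [affinelyDerived, affinelyDerived, ← h]
  refine Polynomial.map_aeval_eq_aeval_map ?_ _ _
  ext a
  simp [MvPolynomial.algebraMap_eq]

end ChangeOfVariables

section ZeroDimensional

theorem ringKrullDim_eq_zero_of_finrank_pos {k S : Type*} [Field k] [CommRing S] [Algebra k S]
    (h : 0 < Module.finrank k S) : ringKrullDim S = 0 := by
  have := Module.finite_of_finrank_pos h
  have := Module.nontrivial_of_finrank_pos h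
  have := IsArtinianRing.of_finite k S
  exact ringKrullDimZero_iff_ringKrullDim_eq_zero.1 inferInstance

variable {k : Type*} [Field k] (L : Type*) [Field L] [Algebra k L] {n : ℕ}

theorem zeroLocus_anti {I J : Ideal (MvPolynomial (Fin n) k)} (h : I ≤ J) :
    zeroLocus L J ⊆ zeroLocus L I :=
  fun _ hx f hf => hx f (h hf)

theorem finite_zeroLocus (I : Ideal (MvPolynomial (Fin n) k))
    [Module.Finite k (MvPolynomial (Fin n) k ⧸ I)] : (zeroLocus L I).Finite := by
  let eval : zeroLocus L I → (MvPolynomial (Fin n) k ⧸ I) →ₐ[k] L := fun x =>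
    Ideal.Quotient.liftₐ I (aeval x.1) x.2
  have heval : Function.Injective eval := fun x y h => Subtype.ext <| funext fun i => by
    have hX : ∀ z, eval z (Ideal.Quotient.mk I (X i)) = z.1 i := fun z => aeval_X z.1 i
    rw [← hX x, ← hX y, h]
  exact Set.finite_coe_iff.1 (Finite.of_injective eval heval)

end ZeroDimensional

section Homogenization

theorem homogeneousComponent_aeval_of_isHomogeneous_one {σ R : Type*} [CommSemiring R]
    {l : MvPolynomial σ R} (hl : l.IsHomogeneous 1) (p : Polynomial R) (j : ℕ) :
    homogeneousComponent j (Polynomial.aeval l p) = C (p.coeff j) * l ^ j := by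
  have hpow : ∀ i, (l ^ i).IsHomogeneous i := fun i => by simpa using hl.pow i
  have hterm : ∀ i, homogeneousComponent j (p.coeff i • l ^ i) =
      if i = j then C (p.coeff j) * l ^ j else 0 := by
    intro i
    rw [map_smul, homogeneousComponent_of_mem ((mem_homogeneousSubmodule _ _).2 (hpow i))]
    by_cases hij : i = j
    · simp [hij, smul_eq_C_mul]
    · simp [hij, Ne.symm hij]
  rw [Polynomial.aeval_eq_sum_range, map_sum]
  simp only [hterm, Finset.sum_ite_eq', Finset.mem_range]
  split_ifs with hj
  · rfl
  · rw [Polynomial.coeff_eq_zero_of_natDegree_lt (by omega), map_zero, zero_mul]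

theorem totalDegree_aeval_of_isHomogeneous_one {σ R : Type*} [CommSemiring R] [NoZeroDivisors R]
    {l : MvPolynomial σ R} (hl : l.IsHomogeneous 1) (hl0 : l ≠ 0) (p : Polynomial R) :
    (Polynomial.aeval l p).totalDegree = p.natDegree := by
  rcases eq_or_ne p 0 with rfl | hp
  · simp
  apply le_antisymm
  · rw [Polynomial.aeval_eq_sum_range]
    refine totalDegree_finsetSum_le fun i hi => (totalDegree_smul_le _ _).trans ?_
    have hpow : (l ^ i).IsHomogeneous i := by simpa using hl.pow i
    exact hpow.totalDegree_le.trans (Nat.lt_succ_iff.1 (Finset.mem_range.1 hi))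
  · by_contra! h
    have h0 := homogeneousComponent_eq_zero _ _ h
    rw [homogeneousComponent_aeval_of_isHomogeneous_one hl] at h0
    exact mul_ne_zero (by simpa using hp) (pow_ne_zero _ hl0) h0

variable {K : Type*} [Field K] {n : ℕ}

theorem isHomogeneous_affineForm_zero (a : Fin n → K) : (affineForm a 0).IsHomogeneous 1 := by
  rw [affineForm, map_zero, add_zero]
  refine IsHomogeneous.sum _ _ _ fun j _ => ?_
  simpa using (isHomogeneous_C (Fin n) (a j)).mul (isHomogeneous_X K j)

theorem aeval_affineForm_eq_aeval_taylor (a : Fin n → K) (c : K) (p : Polynomial K) :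
    Polynomial.aeval (affineForm a c) p =
      Polynomial.aeval (affineForm a 0) (Polynomial.taylor c p) := by
  rw [Polynomial.taylor_apply, Polynomial.aeval_comp]
  congr 2
  simp [affineForm]

theorem homogeneousComponent_totalDegree_aeval_affineForm {a : Fin n → K}
    (ha : affineForm a 0 ≠ 0) (c : K) (p : Polynomial K) :
    homogeneousComponent (Polynomial.aeval (affineForm a c) p).totalDegree
        (Polynomial.aeval (affineForm a c) p) =
      C p.leadingCoeff * affineForm a 0 ^ p.natDegree := by
  have hl := isHomogeneous_affineForm_zero a
  rw [aeval_affineForm_eq_aeval_taylor, totalDegree_aeval_of_isHomogeneous_one hl ha,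
    homogeneousComponent_aeval_of_isHomogeneous_one hl, Polynomial.natDegree_taylor,
    Polynomial.coeff_taylor_natDegree]

theorem degree_le_totalDegree {σ R : Type*} [CommSemiring R] {f : MvPolynomial σ R} {d : σ →₀ ℕ}
    (hd : d ∈ f.support) : d.degree ≤ f.totalDegree := by
  rw [Finsupp.degree_apply]
  exact le_totalDegree hd

theorem isHomogeneous_homogenize (f : MvPolynomial (Fin n) K) :
    (homogenize f).IsHomogeneous f.totalDegree := by
  refine IsHomogeneous.sum _ _ _ fun d hd => isHomogeneous_monomial _ ?_
  have hle := degree_le_totalDegree hd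
  rw [Finsupp.degree_eq_sum, Fin.sum_univ_succ]
  simp only [Finsupp.cons_zero, Finsupp.cons_succ]
  rw [← Finsupp.degree_eq_sum]
  omega

theorem mapDomain_succ_eq_cons {M : Type*} [AddCommMonoid M] (d : Fin n →₀ M) :
    Finsupp.mapDomain Fin.succ d = Finsupp.cons 0 d := by
  ext j
  refine Fin.cases ?_ (fun j => ?_) j
  · rw [Finsupp.cons_zero, Finsupp.mapDomain_of_notMem_range]
    rintro ⟨i, hi⟩
    exact Fin.succ_ne_zero i hi
  · rw [Finsupp.cons_succ, Finsupp.mapDomain_apply (Fin.succ_injective n)]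

theorem homogenize_sub_rename_mem (f : MvPolynomial (Fin n) K) :
    homogenize f - rename Fin.succ (homogeneousComponent f.totalDegree f) ∈
      Ideal.span {(X 0 : MvPolynomial (Fin (n + 1)) K)} := by
  classical
  rw [homogeneousComponent_apply, homogenize, map_sum, Finset.sum_filter,
    ← Finset.sum_sub_distrib]
  refine Ideal.sum_mem _ fun d hd => ?_
  have hle := degree_le_totalDegree hd
  split_ifs with h
  · rw [rename_monomial, mapDomain_succ_eq_cons, h, Nat.sub_self, sub_self]
    exact Ideal.zero_mem _
  · rw [sub_zero, Ideal.mem_span_singleton, X_dvd_monomial]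
    right
    rw [Finsupp.cons_zero]
    omega

theorem aeval_homogenize {L : Type*} [Field L] [Algebra K L] (f : MvPolynomial (Fin n) K)
    {x : Fin (n + 1) → L} (hx : x 0 ≠ 0) :
    aeval x (homogenize f) = x 0 ^ f.totalDegree * aeval (fun i => x i.succ / x 0) f := by
  conv_rhs => rw [← f.support_sum_monomial_coeff, map_sum, f.support_sum_monomial_coeff]
  rw [homogenize, map_sum, Finset.mul_sum]
  refine Finset.sum_congr rfl fun d hd => ?_
  have hle := degree_le_totalDegree hd
  have hpow : x 0 ^ f.totalDegree = x 0 ^ (f.totalDegree - d.degree) * ∏ i, x 0 ^ d i := by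
    rw [Finset.prod_pow_eq_pow_sum, ← Finsupp.degree_eq_sum, ← pow_add, Nat.sub_add_cancel hle]
  have h0 : ∏ i, x 0 ^ d i ≠ 0 := Finset.prod_ne_zero_iff.2 fun i _ => pow_ne_zero _ hx
  rw [aeval_monomial, aeval_monomial, Finsupp.prod_fintype _ _ (fun _ => pow_zero _),
    Finsupp.prod_fintype _ _ (fun _ => pow_zero _), Fin.prod_univ_succ, Finsupp.cons_zero, hpow]
  simp only [Finsupp.cons_succ, div_pow, Finset.prod_div_distrib]
  field_simp

end Homogenization

section GenericCoordinates

attribute [local instance] MvPolynomial.gradedAlgebra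

theorem mem_saturation_of_mul_mem {R : Type*} [CommRing R] {J M : Ideal R} {x f : R} {N : ℕ}
    (hN : M ^ N ≤ J ⊔ Ideal.span {x}) (h : f * x ∈ saturation J M) : f ∈ saturation J M := by
  obtain ⟨i, hi⟩ := h
  refine ⟨N + i, fun u hu => ?_⟩
  rw [pow_add] at hu
  refine Submodule.mul_induction_on hu (fun v hv w hw => ?_) fun v w hv hw => ?_
  · obtain ⟨j, hj, r, hr, rfl⟩ := Submodule.mem_sup.1 (hN hv)
    obtain ⟨s, rfl⟩ := Ideal.mem_span_singleton.1 hr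
    rw [show f * ((j + x * s) * w) = f * w * j + s * (f * x * w) by ring]
    exact J.add_mem (J.mul_mem_left _ hj) (J.mul_mem_left _ (hi w hw))
  · rw [mul_add]
    exact J.add_mem hv hw

theorem mk_mem_nonZeroDivisors_saturation {R : Type*} [CommRing R] {J M : Ideal R} {x : R}
    {N : ℕ} (hN : M ^ N ≤ J ⊔ Ideal.span {x}) :
    Ideal.Quotient.mk (saturation J M) x ∈ nonZeroDivisors (R ⧸ saturation J M) := by
  rw [mem_nonZeroDivisors_iff_right]
  intro z hz
  obtain ⟨f, rfl⟩ := Ideal.Quotient.mk_surjective z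
  rw [← map_mul, Ideal.Quotient.eq_zero_iff_mem] at hz
  exact Ideal.Quotient.eq_zero_iff_mem.2 (mem_saturation_of_mul_mem hN hz)

variable {K : Type*} [Field K] {n N : ℕ}

section ProjectiveZeros

variable {L : Type*} [Field L]

/-- The affine coordinates of a point of projective space in the chart `x₀ ≠ 0`. Outside this chart
they are the junk value `0`. -/
def affineCoordinates (p : Projectivization L (Fin (n + 1) → L)) (i : Fin n) : L :=
  p.rep i.succ / p.rep 0

theorem eq_of_affineCoordinates_eq {p q : Projectivization L (Fin (n + 1) → L)}
    (hp : p.rep 0 ≠ 0) (hq : q.rep 0 ≠ 0) (h : affineCoordinates p = affineCoordinates q) :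
    p = q := by
  rw [← p.mk_rep, ← q.mk_rep, Projectivization.mk_eq_mk_iff']
  refine ⟨p.rep 0 / q.rep 0, funext fun j => ?_⟩
  refine Fin.cases ?_ (fun j => ?_) j
  · simp [hq]
  · have hj : p.rep j.succ / p.rep 0 = q.rep j.succ / q.rep 0 := congrFun h j
    rw [div_eq_div_iff hp hq] at hj
    rw [Pi.smul_apply, smul_eq_mul, div_mul_eq_mul_div, div_eq_iff hq, hj, mul_comm]

variable [Algebra K L] {G : Set (MvPolynomial (Fin n) K)}
  {p : Projectivization L (Fin (n + 1) → L)}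

theorem rep_zero_ne_zero_of_mem_projZeroLocus {J : Ideal (MvPolynomial (Fin (n + 1)) K)}
    (hN : irrelevantIdeal K n ^ N ≤ J ⊔ Ideal.span {X 0}) (hp : p ∈ projZeroLocus L J) :
    p.rep 0 ≠ 0 := by
  intro h0
  have hle : J ⊔ Ideal.span {X 0} ≤ RingHom.ker (aeval p.rep : _ →ₐ[K] L) := by
    refine sup_le hp ?_
    rw [Ideal.span_singleton_le_iff_mem, RingHom.mem_ker, aeval_X, h0]
  refine p.rep_nonzero (funext fun j => ?_)
  have hj := hle (hN (Ideal.pow_mem_pow (Ideal.subset_span (Set.mem_range_self j)) N))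
  rw [RingHom.mem_ker, map_pow, aeval_X] at hj
  exact eq_zero_of_pow_eq_zero hj

theorem affineCoordinates_mem_zeroLocus (h0 : p.rep 0 ≠ 0)
    (hp : p ∈ projZeroLocus L (Ideal.span (homogenize '' G))) :
    affineCoordinates p ∈ zeroLocus L (Ideal.span G) := by
  suffices Ideal.span G ≤ RingHom.ker (aeval (affineCoordinates p) : _ →ₐ[K] L) from this
  rw [Ideal.span_le]
  intro f hf
  have hf0 := hp _ (Ideal.subset_span ⟨f, hf, rfl⟩)
  rw [aeval_homogenize f h0] at hf0
  exact (mul_eq_zero.1 hf0).resolve_left (pow_ne_zero _ h0)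

theorem finite_projZeroLocus_span_homogenize (hfin : (zeroLocus L (Ideal.span G)).Finite)
    (hN : irrelevantIdeal K n ^ N ≤ Ideal.span (homogenize '' G) ⊔ Ideal.span {X 0}) :
    (projZeroLocus L (Ideal.span (homogenize '' G))).Finite :=
  Set.Finite.of_injOn (f := affineCoordinates)
    (fun _ hp =>
      affineCoordinates_mem_zeroLocus (rep_zero_ne_zero_of_mem_projZeroLocus hN hp) hp)
    (fun _ hp _ hq => eq_of_affineCoordinates_eq
      (rep_zero_ne_zero_of_mem_projZeroLocus hN hp) (rep_zero_ne_zero_of_mem_projZeroLocus hN hq))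
    hfin

end ProjectiveZeros

theorem isInGenericCoordinates_span_homogenize {G : Set (MvPolynomial (Fin n) K)}
    (hfin : (zeroLocus (AlgebraicClosure K) (Ideal.span G)).Finite)
    (hN : irrelevantIdeal K n ^ N ≤ Ideal.span (homogenize '' G) ⊔ Ideal.span {X 0}) :
    IsInGenericCoordinates (Ideal.span (homogenize '' G)) := by
  refine ⟨Ideal.homogeneous_span _ _ ?_, finite_projZeroLocus_span_homogenize hfin hN,
    Or.inr (mk_mem_nonZeroDivisors_saturation hN)⟩
  rintro _ ⟨f, -, rfl⟩
  exact ⟨_, isHomogeneous_homogenize f⟩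

theorem rename_affineForm_mem_radical {a : Fin n → K} {c : K} {p : Polynomial K} (hp : p ≠ 0)
    {J : Ideal (MvPolynomial (Fin (n + 1)) K)}
    (hJ : homogenize (Polynomial.aeval (affineForm a c) p) ∈ J) :
    rename Fin.succ (affineForm a 0) ∈ (J ⊔ Ideal.span {X 0}).radical := by
  rcases eq_or_ne (affineForm a 0) 0 with ha | ha
  · rw [ha, map_zero]
    exact Ideal.zero_mem _
  have htop := (Submodule.sub_mem_iff_right _ (Ideal.mem_sup_left hJ)).1
    (Ideal.mem_sup_right (S := J) (homogenize_sub_rename_mem _))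
  rw [homogeneousComponent_totalDegree_aeval_affineForm ha, map_mul, map_pow, rename_C] at htop
  have hunit : IsUnit (C p.leadingCoeff : MvPolynomial (Fin (n + 1)) K) :=
    (isUnit_iff_ne_zero.2 (Polynomial.leadingCoeff_ne_zero.2 hp)).map C
  exact ⟨p.natDegree, (Ideal.unit_mul_mem_iff_mem _ hunit).1 htop⟩

theorem X_eq_sum_affineForm {A : Matrix (Fin n) (Fin n) K} (hA : IsUnit A.det) (j : Fin n) :
    (X j : MvPolynomial (Fin n) K) = ∑ i, C (A⁻¹ j i) * affineForm (A i) 0 := by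
  have h := aeval_affineForm_eq_X (A.nonsing_inv_mul hA) (b := 0) (c := 0) (by simp) j
  rw [aeval_affineForm, Pi.zero_apply, map_zero, add_zero] at h
  exact h.symm

theorem exists_irrelevantIdeal_pow_le {g : Fin n → Polynomial K} (hg : ∀ i, g i ≠ 0)
    {A : Matrix (Fin n) (Fin n) K} {b : Fin n → K} (hA : IsUnit A.det)
    {J : Ideal (MvPolynomial (Fin (n + 1)) K)}
    (hJ : ∀ i, homogenize (affinelyDerived g A b i) ∈ J) :
    ∃ N, irrelevantIdeal K n ^ N ≤ J ⊔ Ideal.span {X 0} := by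
  refine Ideal.exists_pow_le_of_le_radical_of_fg ?_ (Submodule.fg_span (Set.finite_range _))
  rw [irrelevantIdeal, Ideal.span_le]
  rintro _ ⟨j, rfl⟩
  refine Fin.cases ?_ (fun j => ?_) j
  · exact Ideal.le_radical (Ideal.mem_sup_right (Ideal.mem_span_singleton_self _))
  · rw [← rename_X Fin.succ j, X_eq_sum_affineForm hA, map_sum]
    refine Ideal.sum_mem _ fun i _ => ?_
    rw [map_mul]
    exact Ideal.mul_mem_left _ _ (rename_affineForm_mem_radical (hg i) (hJ i))

theorem isInGenericCoordinates_of_affinelyDerived_mem {g : Fin n → Polynomial K}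
    (hg : ∀ i, g i ≠ 0) {A : Matrix (Fin n) (Fin n) K} {b : Fin n → K} (hA : IsUnit A.det)
    {G : Set (MvPolynomial (Fin n) K)} (hG : ∀ i, affinelyDerived g A b i ∈ G) :
    IsInGenericCoordinates (Ideal.span (homogenize '' G)) := by
  have := finite_quotient_affinelyDerived hg b hA
  have hfin : (zeroLocus (AlgebraicClosure K) (Ideal.span G)).Finite :=
    (finite_zeroLocus _ _).subset (zeroLocus_anti _ (Ideal.span_mono (Set.range_subset_iff.2 hG)))
  obtain ⟨N, hN⟩ := exists_irrelevantIdeal_pow_le hg hA (J := Ideal.span (homogenize '' G))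
    fun i => Ideal.subset_span ⟨_, hG i, rfl⟩
  exact isInGenericCoordinates_span_homogenize hfin hN

end GenericCoordinates

section Radicality

theorem formallyUnramified_of_adjoin_eq_top {R S : Type*} [CommRing R] [CommRing S] [Algebra R S]
    {s : Set S} (hs : Algebra.adjoin R s = ⊤)
    (hroot : ∀ x ∈ s, ∃ p : Polynomial R, p.Separable ∧ Polynomial.aeval x p = 0) :
    Algebra.FormallyUnramified R S := by
  have hD : KaehlerDifferential.D R S = 0 := by
    refine Derivation.ext_of_adjoin_eq_top s hs fun x hx => ?_
    obtain ⟨p, ⟨u, v, huv⟩, hp⟩ := hroot x hx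
    have hunit : Polynomial.aeval x v * Polynomial.aeval x p.derivative = 1 := by
      simpa [hp] using congrArg (Polynomial.aeval x) huv
    have hder := (KaehlerDifferential.D R S).map_aeval p x
    rw [hp, map_zero] at hder
    rw [Derivation.zero_apply, ← one_smul S (KaehlerDifferential.D R S x), ← hunit, mul_smul,
      ← hder, smul_zero]
  refine ⟨(Submodule.subsingleton_iff S).1 (subsingleton_of_bot_eq_top ?_)⟩
  rw [← KaehlerDifferential.span_range_derivation, hD, eq_comm, Submodule.span_eq_bot]
  rintro _ ⟨x, rfl⟩
  rfl

theorem adjoin_mk_affineForm_eq_top {k : Type*} [Field k] {n : ℕ} {A : Matrix (Fin n) (Fin n) k}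
    (b : Fin n → k) (hA : IsUnit A.det) (I : Ideal (MvPolynomial (Fin n) k)) :
    Algebra.adjoin k (Set.range fun i => Ideal.Quotient.mk I (affineForm (A i) (b i))) = ⊤ := by
  have hcomp : aeval (fun i => Ideal.Quotient.mk I (affineForm (A i) (b i))) =
      (Ideal.Quotient.mkₐ k I).comp (affineEquiv A b hA).toAlgHom :=
    MvPolynomial.algHom_ext fun i => by
      rw [aeval_X, AlgHom.comp_apply, AlgEquiv.coe_toAlgHom, affineEquiv_X]
      rfl
  rw [Algebra.adjoin_range_eq_range_aeval, hcomp, AlgHom.range_eq_top]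
  exact (Ideal.Quotient.mkₐ_surjective k I).comp (affineEquiv A b hA).surjective

theorem isRadical_of_affinelyDerived_mem {k : Type*} [Field k] {n : ℕ} {g : Fin n → Polynomial k}
    (hg : ∀ i, (g i).Separable) {A : Matrix (Fin n) (Fin n) k} {b : Fin n → k}
    (hA : IsUnit A.det) {I : Ideal (MvPolynomial (Fin n) k)}
    (hI : ∀ i, affinelyDerived g A b i ∈ I) : I.IsRadical := by
  have := formallyUnramified_of_adjoin_eq_top (adjoin_mk_affineForm_eq_top b hA I) <| by
    rintro _ ⟨i, rfl⟩
    refine ⟨g i, hg i, ?_⟩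
    rw [← Ideal.Quotient.mkₐ_eq_mk k, Polynomial.aeval_algHom_apply]
    exact Ideal.Quotient.eq_zero_iff_mem.2 (hI i)
  rw [Ideal.isRadical_iff_quotient_reduced]
  exact Algebra.FormallyUnramified.isReduced_of_field k _

theorem separable_of_dvd_X_pow_card_sub_X {k : Type*} [Field k] [Finite k] {p : Polynomial k}
    (hp : p ∣ Polynomial.X ^ Nat.card k - Polynomial.X) : p.Separable := by
  have := Fintype.ofFinite k
  refine Polynomial.Separable.of_dvd (galois_poly_separable (ringChar k) _ ?_) hp
  rw [Nat.card_eq_fintype_card]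
  exact (CharP.cast_eq_zero_iff k (ringChar k) _).1 (FiniteField.cast_card_eq_zero k)

end Radicality

end AffineSystem

end

theorem mainTheorem1_general {k : Type*} [Field k] {K : Type*} [Field K] [Algebra k K] {n : ℕ}
    {g : Fin n → Polynomial k} (hg : ∀ i, 0 < (g i).natDegree)
    {A : Matrix (Fin n) (Fin n) k} (b : Fin n → k) (hA : A.rank = n) :
    (∃ φ : MvPolynomial (Fin n) k ≃ₐ[k] MvPolynomial (Fin n) k,
      (∀ i, φ (MvPolynomial.X i) = AffineSystem.affineForm (A i) (b i)) ∧
      (∀ i, φ.symm (MvPolynomial.X i) =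
        AffineSystem.affineForm (A⁻¹ i) (-(A⁻¹.mulVec b) i)) ∧
      (∀ i, φ.symm (AffineSystem.affinelyDerived g A b i) =
        Polynomial.aeval (MvPolynomial.X i) (g i)) ∧
      ∀ m : MonomialOrder (Fin n),
        AffineSystem.IsGroebnerBasis m
          ((Ideal.span (Set.range (AffineSystem.affinelyDerived g A b))).map φ.symm)
          (Set.range fun i => φ.symm (AffineSystem.affinelyDerived g A b i))) ∧
    (ringKrullDim (MvPolynomial (Fin n) k ⧸
        Ideal.span (Set.range (AffineSystem.affinelyDerived g A b))) = 0 ∧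
      (AffineSystem.zeroLocus K
        (Ideal.span (Set.range (AffineSystem.affinelyDerived g A b)))).Finite) ∧
    (Module.Finite k (MvPolynomial (Fin n) k ⧸
        Ideal.span (Set.range (AffineSystem.affinelyDerived g A b))) ∧
      Module.finrank k (MvPolynomial (Fin n) k ⧸
          Ideal.span (Set.range (AffineSystem.affinelyDerived g A b))) =
        ∏ i, (g i).natDegree) ∧
    (∀ G : Set (MvPolynomial (Fin n) K),
      (∀ i, MvPolynomial.map (algebraMap k K) (AffineSystem.affinelyDerived g A b i) ∈ G) →
      AffineSystem.IsInGenericCoordinates (Ideal.span (AffineSystem.homogenize '' G))) ∧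
    ((∀ i, (g i).Separable) →
      ∀ I : Ideal (MvPolynomial (Fin n) k),
        (∀ i, AffineSystem.affinelyDerived g A b i ∈ I) → I.IsRadical) := by
  have hdet := AffineSystem.isUnit_det_of_rank_eq hA
  have hg0 : ∀ i, g i ≠ 0 := fun i => Polynomial.ne_zero_of_natDegree_gt (hg i)
  have hfinite := AffineSystem.finite_quotient_affinelyDerived hg0 b hdet
  have hfinrank := AffineSystem.finrank_quotient_affinelyDerived hg0 b hdet
  refine ⟨⟨AffineSystem.affineEquiv A b hdet, AffineSystem.affineEquiv_X A b hdet,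
      AffineSystem.affineEquiv_symm_X A b hdet,
      AffineSystem.affineEquiv_symm_affinelyDerived g A b hdet,
      fun m => AffineSystem.isGroebnerBasis_map_span_affinelyDerived m hg0 A b hdet⟩,
    ⟨AffineSystem.ringKrullDim_eq_zero_of_finrank_pos (k := k)
        (hfinrank ▸ Finset.prod_pos fun i _ => hg i),
      AffineSystem.finite_zeroLocus K _⟩,
    ⟨hfinite, hfinrank⟩, fun G hG => ?_,
    fun hsep _ hI => AffineSystem.isRadical_of_affinelyDerived_mem hsep hdet hI⟩
  have hdetK : IsUnit (A.map (algebraMap k K)).det :=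
    (algebraMap k K).map_det A ▸ hdet.map (algebraMap k K)
  simp only [AffineSystem.map_affinelyDerived] at hG
  exact AffineSystem.isInGenericCoordinates_of_affinelyDerived_mem
    (fun i => Polynomial.map_ne_zero (hg0 i)) hdetK hG

theorem mainTheorem1 {k : Type*} [Field k] {K : Type*} [Field K] [Algebra k K] [IsAlgClosure k K]
    (n : ℕ) (hn : 1 ≤ n)
    (g : Fin n → Polynomial k) (hg : ∀ i, 0 < (g i).natDegree)
    (A : Matrix (Fin n) (Fin n) k) (b : Fin n → k) (hA : A.rank = n)
    (F : Fin n → MvPolynomial (Fin n) k) (hF : F = AffineSystem.affinelyDerived g A b) :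
    -- (1) the affine change of variables `y = A x + b` is invertible and turns the system
    -- into a Gröbner basis for all LEX and DRL term orders
    (∃ φ : MvPolynomial (Fin n) k ≃ₐ[k] MvPolynomial (Fin n) k,
      (∀ i, φ (MvPolynomial.X i) = AffineSystem.affineForm (A i) (b i)) ∧
      (∀ i, φ.symm (MvPolynomial.X i) =
        AffineSystem.affineForm (A⁻¹ i) (-(A⁻¹.mulVec b) i)) ∧
      (∀ i, φ.symm (F i) = Polynomial.aeval (MvPolynomial.X i) (g i)) ∧
      ∀ e : Equiv.Perm (Fin n),
        AffineSystem.IsGroebnerBasis (AffineSystem.LEX e)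
          ((Ideal.span (Set.range F)).map φ.symm) (Set.range fun i => φ.symm (F i)) ∧
        AffineSystem.IsGroebnerBasis (AffineSystem.DRL e)
          ((Ideal.span (Set.range F)).map φ.symm) (Set.range fun i => φ.symm (F i))) ∧
    -- (2) the system is zero-dimensional
    (ringKrullDim (MvPolynomial (Fin n) k ⧸ Ideal.span (Set.range F)) = 0 ∧
      (AffineSystem.zeroLocus K (Ideal.span (Set.range F))).Finite) ∧
    -- (3) the dimension of the quotient
    (Module.Finite k (MvPolynomial (Fin n) k ⧸ Ideal.span (Set.range F)) ∧
      Module.finrank k (MvPolynomial (Fin n) k ⧸ Ideal.span (Set.range F)) =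
        ∏ i, (g i).natDegree) ∧
    -- (4) larger proper systems over the algebraic closure are in generic coordinates
    (∀ G : Set (MvPolynomial (Fin n) K),
      (∀ i, MvPolynomial.map (algebraMap k K) (F i) ∈ G) →
      Ideal.span G ≠ ⊤ →
      AffineSystem.IsInGenericCoordinates (Ideal.span (AffineSystem.homogenize '' G))) ∧
    -- (5) radicality over finite fields
    (Finite k →
      (∀ i, g i ∣ (Polynomial.X ^ Nat.card k - Polynomial.X : Polynomial k)) →
      ∀ I : Ideal (MvPolynomial (Fin n) k), (∀ i, F i ∈ I) → I.IsRadical) := by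
  subst hF
  obtain ⟨⟨φ, hφ, hφ_symm, hφ_derived, hgroebner⟩, h_dim, h_rank, h_generic, h_radical⟩ :=
    mainTheorem1_general (K := K) hg b hA
  exact ⟨⟨φ, hφ, hφ_symm, hφ_derived, fun e => ⟨hgroebner _, hgroebner _⟩⟩, h_dim, h_rank,
    fun G hG _ => h_generic G hG, fun _ hdvd => h_radical fun i =>
      AffineSystem.separable_of_dvd_X_pow_card_sub_X (hdvd i)⟩
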